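/- Let $\log^* n$ denote the least $k$ with $n \le 2\uparrow\uparrow k$ (the number of times $\log_2$ must be applied to $n$ until the result is at most $1$). For a graph $G$ and vertex covers $\alpha,\beta$ of $G$, an $\ell$-batch schedule from $\alpha$ to $\beta$ is a sequence $V_0=\alpha,V_1,\dots,V_\ell=\beta$ of vertex covers of $G$ such that each batch $V_i\oplus V_{i+1}$ is an independent set of $G$. It is monotone if every node lies in at most one batch, and it is an $(\eta,a)$-approximation if $|V_i\cup V_{i+1}|\le \eta\max\{|\alpha|,|\beta|\}+a$ for all $0\le i<\ell$; an $\eta$-approximation is an $(\eta,0)$-approximation. In the deterministic LOCAL model, the nodes have unique IDs from an ID space of size $R(n)\ge n$, initially know their ID, their degree, whether they belong to $\alpha$ and to $\beta$, and $n$, and may send one message of unbounded size to each neighbor in each synchronous round. A $T$-round algorithm computes a schedule on a graph if, for all vertex covers $\alpha,\beta$ and all assignments of IDs, each node knows after $T$ rounds its membership in each $V_i$. There is an absolute constant $c>0$ such that the following holds. Let $\varepsilon\in(0,1)$ be a constant, and let $\ell:\mathbb N\to\mathbb N$ satisfy $\ell(n)<n$ for all large enough $n$. Suppose that the ID space has size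 $R(n)=\Omega(n\,\ell(n)\log n)$, and that a $T(n)$-round LOCAL algorithm computes a monotone $\ell(n)$-batch $(2-\varepsilon)$-approximation schedule on the cycle $C_n$ for every large enough even $n$. Then $T(n)\cdot\log^*\ell(n)\ge c\log^* n$ for every large enough even $n$; that is, $T(n)=\Omega(\log^* n/\log^*\ell(n))$. In particular, for all constants $\varepsilon\in(0,1)$, $a\ge 0$ and $L\in\mathbb N$ there is a constant $c>0$ such that, for an ID space of size $\Omega(n\log n)$, any $T(n)$-round LOCAL algorithm that computes a monotone $L$-batch $(2-\varepsilon,a)$-approximation schedule on $C_n$ for every large enough even $n$ satisfies $T(n)\ge c\log^* n$ for every large enough even $n$. (So, for constant $\varepsilon$, a runtime of $O(\log^*(n)/\varepsilon)$ for computing monotone $O(1/\varepsilon)$-batch $(1+\varepsilon,3)$-approximation schedules is asymptotically tight in $n$.) -/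

import Mathlib

namespace VCReconf

/-- The power tower `2 ↑↑ k` of height `k`. -/
def tower : ℕ → ℕ
  | 0 => 1
  | k + 1 => 2 ^ tower k

theorem lt_tower (k : ℕ) : k < tower k := by
  induction k with
  | zero => decide
  | succ k ih =>
    have h : tower k < 2 ^ tower k := Nat.lt_two_pow_self
    show k + 1 < 2 ^ tower k
    omega

theorem exists_le_tower (n : ℕ) : ∃ k, n ≤ tower k := ⟨n, (lt_tower n).le⟩

/-- The iterated (binary) logarithm `log* n`: the number of times `log₂` has to be applied to `n`
until the result is at most `1`, i.e. the least `k` with `n ≤ 2 ↑↑ k`. -/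
def logStar (n : ℕ) : ℕ := Nat.find (exists_le_tower n)

section Schedules

variable {V : Type*} [DecidableEq V]

/-- `S 0, S 1, …, S ℓ` is a vertex cover reconfiguration schedule from `α` to `β` in `G`, with `ℓ`
batches and of cost (at most) `s`. Entries `S i` with `i > ℓ` are irrelevant. -/
structure IsSchedule (G : SimpleGraph V) (α β : Finset V) (ℓ : ℕ) (s : ℝ)
    (S : ℕ → Finset V) : Prop where
  cover : ∀ i ≤ ℓ, G.IsVertexCover (S i : Set V)
  first : S 0 = α
  last : S ℓ = β
  cost : ∀ i < ℓ, ((S i ∪ S (i + 1)).card : ℝ) ≤ s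
  indep : ∀ i < ℓ, G.IsIndepSet (symmDiff (S i) (S (i + 1)) : Finset V)

/-- Every node is changed in at most one of the `ℓ` batches `S i ⊕ S (i + 1)`. -/
def IsMonotoneSchedule (ℓ : ℕ) (S : ℕ → Finset V) : Prop :=
  ∀ v : V, ∀ i < ℓ, ∀ j < ℓ,
    v ∈ symmDiff (S i) (S (i + 1)) → v ∈ symmDiff (S j) (S (j + 1)) → i = j

/-- An `ℓ`-batch schedule from `α` to `β` that is an `(η, c)`-approximation: its cost is at most
`η * max |α| |β| + c`. -/
def IsApproxSchedule (G : SimpleGraph V) (α β : Finset V) (ℓ : ℕ) (η c : ℝ)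
    (S : ℕ → Finset V) : Prop :=
  IsSchedule G α β ℓ (η * (max α.card β.card : ℕ) + c) S

end Schedules

/-- A port numbering of `G`: every node `v` numbers its incident edges by `0, …, deg v - 1`;
`port v u` is the number that `v` gives to the edge towards its neighbour `u`. -/
structure PortNumbering {V : Type*} (G : SimpleGraph V) where
  port : V → V → ℕ
  port_lt : ∀ v u, G.Adj v u → port v u < (G.neighborSet v).ncard
  port_inj : ∀ v, Set.InjOn (port v) (G.neighborSet v)

/-- A deterministic algorithm of the LOCAL model, for nodes with inputs in `X` and outputs in `Y`.
There is no bound on the size of states and messages, nor on local computation.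
* `init`: the initial state of a node, from its ID, its input and its degree;
* `send`: the message sent through each port in the current round;
* `recv`: the new state, from the old one and the set of the received messages, each paired with
  the port through which it arrives;
* `out`: the output of a node, read off its state after the last round. -/
structure LocalAlgorithm (X Y : Type) where
  State : Type
  Msg : Type
  init : ℕ → X → ℕ → State
  send : State → ℕ → Msg
  recv : State → Set (ℕ × Msg) → State
  out : State → Y

namespace LocalAlgorithm

variable {V : Type*} {X Y : Type}

/-- The state of each node after the given number of synchronous rounds, in the network `G` with
port numbering `P`, IDs `id` and inputs `x`. -/
noncomputable def stateAfter (A : LocalAlgorithm X Y) (G : SimpleGraph V) (P : PortNumbering G)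
    (id : V → ℕ) (x : V → X) : ℕ → V → A.State
  | 0, v => A.init (id v) (x v) (G.neighborSet v).ncard
  | t + 1, v => A.recv (A.stateAfter G P id x t v)
      {m | ∃ u, G.Adj v u ∧
        m = (P.port v u, A.send (A.stateAfter G P id x t u) (P.port u v))}

/-- The output of each node when the algorithm is stopped after `T` rounds. -/
noncomputable def output (A : LocalAlgorithm X Y) (G : SimpleGraph V) (P : PortNumbering G)
    (id : V → ℕ) (x : V → X) (T : ℕ) (v : V) : Y :=
  A.out (A.stateAfter G P id x T v)

end LocalAlgorithm

/-- An algorithm for the reconfiguration problem: the input of a node `v` tells whether `v ∈ α` and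
whether `v ∈ β`; the output of `v` tells, for each `i`, whether `v` belongs to the `i`-th cover. -/
abbrev ReconfAlgorithm := LocalAlgorithm (Bool × Bool) (ℕ → Bool)

/-- The sequence of sets of nodes that is computed by `T` rounds of the algorithm. -/
noncomputable def ReconfAlgorithm.schedule {V : Type*} [Fintype V] [DecidableEq V]
    (A : ReconfAlgorithm) (G : SimpleGraph V) (P : PortNumbering G) (id : V → ℕ)
    (α β : Finset V) (T : ℕ) (i : ℕ) : Finset V :=
  Finset.univ.filter fun v =>
    A.output G P id (fun u => (decide (u ∈ α), decide (u ∈ β))) T v i = true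

/-- In `T` rounds on the graph `G`, with unique IDs from the ID space `{0, …, R - 1}`, the algorithm
computes a monotone `ℓ`-batch `(η, c)`-approximation schedule, for every pair of vertex covers,
every assignment of IDs and every port numbering. -/
def ReconfAlgorithm.ComputesMonotoneApprox {V : Type*} [Fintype V] [DecidableEq V]
    (A : ReconfAlgorithm) (G : SimpleGraph V) (R T ℓ : ℕ) (η c : ℝ) : Prop :=
  ∀ (α β : Finset V) (id : V → ℕ) (P : PortNumbering G),
    G.IsVertexCover (α : Set V) → G.IsVertexCover (β : Set V) →
    Function.Injective id → (∀ v, id v < R) →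
    IsApproxSchedule G α β ℓ η c (A.schedule G P id α β T) ∧
      IsMonotoneSchedule ℓ (A.schedule G P id α β T)

end VCReconf

/-! Let `α` be the even and `β` the odd nodes of the cycle. After `T` rounds, the time at which an
odd node joins the cover depends only on the `2T + 1` IDs around it, so it colours ID windows with
`ℓ + 1` colours. Linial's shift-graph argument yields long ID sequences whose windows all have one
colour (`exists_isMonoBlock`). Disjoint sequences of a common colour, laid along the cycle, make
almost all odd nodes join at the same time (`exists_block_sequence`).

A joining node is uncovered until then, so its neighbour is in the cover and, batches being
independent, cannot leave in the same batch (`mem_of_joinTime_eq`). Hence some cover contains almost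
all nodes, twice `max |α| |β|`, against the factor `2 - ε` (`cost_lower_bound`).

The blocks exist as long as a power tower of height about `log* ℓ + 2T` stays below the number of
IDs, which holds if `8 T log* ℓ < log* n` (`logStar_le_of_computes`). -/

namespace VCReconf

/-! ### Shift-graph colourings: monochromatic runs of windows. -/

section ShiftGraph

/-- A colouring of the increasing `(w + 1)`-tuples over a large enough set `X` gives two
consecutive windows the same colour. -/
theorem exists_consecutive_eq (w : ℕ) : ∀ {C : Type} [Fintype C] (X : Finset ℕ)
    (c : (ℕ → ℕ) → C),
    (∀ x y : ℕ → ℕ, (∀ k ≤ w, x k = y k) → c x = c y) →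
    (2 ^ ·)^[w] (Fintype.card C) < X.card →
    ∃ y : ℕ → ℕ, (∀ k ≤ w + 1, y k ∈ X) ∧ (∀ k ≤ w, y k < y (k + 1)) ∧
      c y = c (fun k => y (k + 1)) := by
  induction w with
  | zero =>
    intro C _ X c hc hX
    obtain ⟨a, ha, b, hb, hab, h⟩ := Finset.exists_ne_map_eq_of_card_lt_of_maps_to
      (s := X) (t := Finset.univ) (f := fun a => c fun _ => a)
      (by simpa [Finset.card_univ] using hX) (by simp)
    wlog hlt : a < b generalizing a b
    · exact this b hb a ha hab.symm h.symm (by omega)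
    refine ⟨fun k => if k = 0 then a else b, ?_, ?_, ?_⟩
    · intro k _
      dsimp only
      split_ifs <;> assumption
    · intro k hk
      obtain rfl : k = 0 := by omega
      simpa using hlt
    · calc c _ = c fun _ => a := hc _ _ (by intro k hk; simp; omega)
        _ = c fun _ => b := h
        _ = _ := hc _ _ (by intro k hk; simp)
  | succ w ih =>
    intro C _ X c hc hX
    classical
    -- A shorter tuple is coloured by the set of colours of its one-element extensions: one entry
    -- less, exponentially more colours.
    obtain ⟨y, hyX, hy, hcy⟩ := ih (C := Set C) X
      (fun x => {a | ∃ z ∈ X, x w < z ∧ c (Function.update x (w + 1) z) = a})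
      (by
        intro x y hxy
        have h : ∀ z, c (Function.update x (w + 1) z) = c (Function.update y (w + 1) z) := by
          intro z
          refine hc _ _ fun k hk => ?_
          by_cases h : k = w + 1
          · simp [h]
          · simpa [Function.update_of_ne h] using hxy k (by omega)
        simp only [h, hxy w le_rfl])
      (by simpa [Function.iterate_succ_apply] using hX)
    have hmem : c y ∈ {a | ∃ z ∈ X, y w < z ∧ c (Function.update y (w + 1) z) = a} :=
      ⟨y (w + 1), hyX _ le_rfl, hy w le_rfl, by rw [Function.update_eq_self]⟩
    -- The colour of `y` also extends the shifted tuple; the extending element `z` completes the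
    -- second window.
    rw [hcy] at hmem
    obtain ⟨z, hzX, hz, hcz⟩ := hmem
    refine ⟨Function.update y (w + 2) z, ?_, ?_, ?_⟩
    · intro k hk
      by_cases h : k = w + 2
      · simpa [h] using hzX
      · simpa [Function.update_of_ne h] using hyX k (by omega)
    · intro k hk
      rw [Function.update_of_ne (by omega)]
      by_cases h : k = w + 1
      · simpa [h] using hz
      · rw [Function.update_of_ne (by omega)]
        exact hy k (by omega)
    · rw [hc (Function.update y (w + 2) z) y
        (fun k hk => Function.update_of_ne (by omega) _ _), ← hcz]
      refine hc _ _ fun k hk => ?_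
      by_cases h : k = w + 1
      · simp [h]
      · rw [Function.update_of_ne h, Function.update_of_ne (by omega)]

/-- `y` starts with `m` consecutive windows of `w + 1` increasing elements of `X`, all of
colour `a`. -/
structure IsMonoBlock {C : Type} (X : Finset ℕ) (w m : ℕ) (c : (ℕ → ℕ) → C) (a : C)
    (y : ℕ → ℕ) : Prop where
  mem : ∀ k < m + w, y k ∈ X
  lt : ∀ k, k + 1 < m + w → y k < y (k + 1)
  color : ∀ j < m, c (fun k => y (j + k)) = a

/-- Each window's colour is refined by the lengths, up to `m`, of the monochromatic blocks starting
with it. If two consecutive windows agree in this refined colour, a block starting at the first has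
a copy starting at the second, and prepending `y 0` lengthens it by one. So `m` costs only a factor
`2 ^ m` in the colours, not further exponentials. -/
theorem exists_isMonoBlock {C : Type} [Fintype C] (X : Finset ℕ) (w m : ℕ)
    (c : (ℕ → ℕ) → C) (hc : ∀ x y : ℕ → ℕ, (∀ k ≤ w, x k = y k) → c x = c y)
    (hX : (2 ^ ·)^[w] (Fintype.card C * 2 ^ m) < X.card) :
    ∃ a y, IsMonoBlock X w m c a y := by
  classical
  obtain ⟨y, hyX, hy, hcy⟩ := exists_consecutive_eq w (C := C × (Fin m → Prop)) X
    (fun x => (c x, fun r => ∃ z, (∀ k ≤ w, z k = x k) ∧ IsMonoBlock X w (r + 1) c (c x) z))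
    (by
      intro x y hxy
      have h : ∀ z : ℕ → ℕ, (∀ k ≤ w, z k = x k) ↔ ∀ k ≤ w, z k = y k := fun z =>
        forall₂_congr fun k hk => by rw [hxy k hk]
      simp only [h, hc x y hxy])
    (by simpa using hX)
  rw [Prod.mk.injEq] at hcy
  obtain ⟨h1, h2⟩ := hcy
  have key : ∀ r < m, ∃ z, (∀ k ≤ w, z k = y k) ∧ IsMonoBlock X w (r + 1) c (c y) z := by
    intro r
    induction r with
    | zero =>
      intro _
      refine ⟨y, fun _ _ => rfl, fun k hk => hyX k (by omega), fun k hk => hy k (by omega), ?_⟩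
      intro j hj
      obtain rfl : j = 0 := by omega
      simp
    | succ r ih =>
      intro hr
      have h := ih (by omega)
      -- Equality of refined colours moves the block from the window of `y` to its shift.
      rw [show (∃ z, (∀ k ≤ w, z k = y k) ∧ IsMonoBlock X w (r + 1) c (c y) z) =
        _ from congrFun h2 ⟨r, by omega⟩, ← h1] at h
      obtain ⟨z, hz, hzX, hzlt, hzc⟩ := h
      dsimp only at hzX hzlt hzc
      have hcons : ∀ k ≤ w, (Nat.casesOn k (y 0) z : ℕ) = y k := by
        rintro (_ | k) hk
        · rfl
        · exact hz k (by omega)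
      refine ⟨fun k => Nat.casesOn k (y 0) z, hcons, ?_, ?_, ?_⟩
      · rintro (_ | k) hk
        · exact hyX 0 (by omega)
        · exact hzX k (by omega)
      · rintro (_ | k) hk
        · change y 0 < z 0
          rw [hz 0 (by omega)]
          exact hy 0 (by omega)
        · exact hzlt k (by omega)
      · rintro (_ | j) hj
        · refine hc _ _ fun k hk => ?_
          simpa using hcons k hk
        · rw [← hzc j (by omega)]
          congr 1
          funext k
          rw [show j + 1 + k = (j + k) + 1 by omega]
  obtain _ | m := m
  · exact ⟨c y, y, fun k hk => hyX k (by omega), fun k hk => hy k (by omega), by simp⟩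
  · obtain ⟨z, -, hz⟩ := key m (by omega)
    exact ⟨c y, z, hz⟩

theorem IsMonoBlock.injOn {C : Type} {X : Finset ℕ} {w m : ℕ} {c : (ℕ → ℕ) → C} {a : C}
    {y : ℕ → ℕ} (h : IsMonoBlock X w m c a y) : Set.InjOn y (Set.Iio (m + w)) := by
  have key : ∀ d k, k + d + 1 < m + w → y k < y (k + d + 1) := by
    intro d
    induction d with
    | zero => exact fun k hk => h.lt k hk
    | succ d ih => exact fun k hk => (ih k (by omega)).trans (h.lt _ (by omega))
  intro i hi j hj hij
  simp only [Set.mem_Iio] at hi hj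
  rcases lt_trichotomy i j with hlt | heq | hlt
  · have := key (j - i - 1) i (by omega)
    rw [show i + (j - i - 1) + 1 = j by omega] at this
    omega
  · exact heq
  · have := key (i - j - 1) j (by omega)
    rw [show j + (i - j - 1) + 1 = i by omega] at this
    omega

/-- Greedy extraction of `t` disjoint monochromatic blocks. -/
theorem exists_disjoint_blocks {C : Type} [Fintype C] (w m : ℕ)
    (c : (ℕ → ℕ) → C) (hc : ∀ x y : ℕ → ℕ, (∀ k ≤ w, x k = y k) → c x = c y) (t : ℕ) :
    ∀ X : Finset ℕ, (2 ^ ·)^[w] (Fintype.card C * 2 ^ m) + t * (m + w) < X.card →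
    ∃ (a : ℕ → C) (Y : ℕ → ℕ → ℕ), (∀ i < t, IsMonoBlock X w m c (a i) (Y i)) ∧
      ∀ i < t, ∀ i' < t, ∀ j < m + w, ∀ j' < m + w, Y i j = Y i' j' → i = i' := by
  classical
  induction t with
  | zero =>
    intro X hX
    -- With no blocks required, this only supplies an element of `C`.
    obtain ⟨a, y, -⟩ := exists_isMonoBlock X w m c hc (by simpa using hX)
    exact ⟨fun _ => a, fun _ => y, by simp, by simp⟩
  | succ t ih =>
    intro X hX
    rw [Nat.succ_mul] at hX
    obtain ⟨a, y, hy⟩ := exists_isMonoBlock X w m c hc (by omega)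
    set Z := (Finset.range (m + w)).image y with hZ
    have hZc : Z.card ≤ m + w := Finset.card_image_le.trans (by simp)
    obtain ⟨b, Y, hY, hdis⟩ := ih (X \ Z) (by
      have := Finset.le_card_sdiff Z X
      omega)
    have hout : ∀ i < t, ∀ j < m + w, ∀ j' < m + w, Y i j ≠ y j' := by
      intro i hi j hj j' hj' h
      have := (Finset.mem_sdiff.1 ((hY i hi).mem j hj)).2
      exact this (h ▸ Finset.mem_image_of_mem y (Finset.mem_range.2 hj'))
    refine ⟨fun i => if i < t then b i else a, fun i => if i < t then Y i else y, ?_, ?_⟩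
    · intro i hi
      by_cases h : i < t
      · simp only [h, if_true]
        exact ⟨fun k hk => (Finset.mem_sdiff.1 ((hY i h).mem k hk)).1, (hY i h).lt,
          (hY i h).color⟩
      · simpa only [h, if_false] using hy
    · intro i hi i' hi' j hj j' hj' h
      by_cases h1 : i < t <;> by_cases h2 : i' < t
      · simp only [h1, h2, if_true] at h
        exact hdis i h1 i' h2 j hj j' hj' h
      · simp only [h1, h2, if_true, if_false] at h
        exact absurd h (hout i h1 j hj j' hj')
      · simp only [h1, h2, if_true, if_false] at h
        exact absurd h.symm (hout i' h2 j' hj' j hj)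
      · omega

/-- A sequence of `s * (m + w)` distinct elements of `X`, composed of `s` blocks all of whose
inner windows have the same colour. -/
theorem exists_block_sequence {C : Type} [Fintype C] [Nonempty C] (w m s : ℕ) (X : Finset ℕ)
    (c : (ℕ → ℕ) → C) (hc : ∀ x y : ℕ → ℕ, (∀ k ≤ w, x k = y k) → c x = c y) (hB : 0 < m + w)
    (hX : (2 ^ ·)^[w] (Fintype.card C * 2 ^ m) + Fintype.card C * s * (m + w) < X.card) :
    ∃ (a : C) (y : ℕ → ℕ), (∀ p < s * (m + w), y p ∈ X) ∧
      Set.InjOn y (Set.Iio (s * (m + w))) ∧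
      ∀ p < s * (m + w), p % (m + w) < m → c (fun k => y (p + k)) = a := by
  classical
  obtain ⟨a, Y, hY, hdis⟩ := exists_disjoint_blocks w m c hc (Fintype.card C * s) X hX
  obtain ⟨b, -, hb⟩ := Finset.exists_le_card_fiber_of_mul_le_card_of_maps_to
    (s := Finset.range (Fintype.card C * s)) (t := Finset.univ) (f := a) (n := s)
    (by simp) Finset.univ_nonempty (by simp [Finset.card_univ])
  obtain ⟨I, hI, hIs⟩ := Finset.exists_subset_card_eq hb
  have hI' : ∀ i ∈ I, i < Fintype.card C * s ∧ a i = b := fun i hi => by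
    simpa using hI hi
  let σ : ℕ → ℕ := fun q => if h : q < s then I.orderEmbOfFin hIs ⟨q, h⟩ else 0
  have hσ : ∀ q < s, σ q < Fintype.card C * s ∧ a (σ q) = b := fun q hq => by
    simp only [σ, hq, dif_pos]
    exact hI' _ (Finset.orderEmbOfFin_mem _ _ _)
  have hσi : ∀ q < s, ∀ q' < s, σ q = σ q' → q = q' := fun q hq q' hq' h => by
    simp only [σ, hq, hq', dif_pos] at h
    simpa using (I.orderEmbOfFin hIs).injective h
  have hdiv : ∀ p < s * (m + w), p / (m + w) < s := fun p hp =>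
    Nat.div_lt_of_lt_mul (by rwa [Nat.mul_comm])
  refine ⟨b, fun p => Y (σ (p / (m + w))) (p % (m + w)), ?_, ?_, ?_⟩
  · intro p hp
    exact (hY _ (hσ _ (hdiv p hp)).1).mem _ (Nat.mod_lt _ hB)
  · intro p hp p' hp' h
    have h1 := hσi _ (hdiv p hp) _ (hdiv p' hp') (hdis _ (hσ _ (hdiv p hp)).1 _
      (hσ _ (hdiv p' hp')).1 _ (Nat.mod_lt _ hB) _ (Nat.mod_lt _ hB) h)
    dsimp only at h
    rw [← h1] at h
    have h2 := (hY _ (hσ _ (hdiv p hp)).1).injOn (Nat.mod_lt _ hB) (Nat.mod_lt _ hB) h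
    rw [← Nat.div_add_mod p (m + w), ← Nat.div_add_mod p' (m + w), h1, h2]
  · intro p hp hpm
    rw [← (hσ _ (hdiv p hp)).2, ← (hY _ (hσ _ (hdiv p hp)).1).color _ hpm]
    refine hc _ _ fun k hk => ?_
    have hlt : p % (m + w) + k < m + w := by omega
    have h1 : (p + k) / (m + w) = p / (m + w) := by
      conv_lhs => rw [← Nat.div_add_mod p (m + w), Nat.add_assoc, Nat.mul_add_div hB,
        Nat.div_eq_of_lt hlt, Nat.add_zero]
    have h2 : (p + k) % (m + w) = p % (m + w) + k := by
      conv_lhs => rw [← Nat.div_add_mod p (m + w), Nat.add_assoc, Nat.mul_add_mod,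
        Nat.mod_eq_of_lt hlt]
    dsimp only
    rw [h1, h2]

end ShiftGraph

/-! ### The algorithm on an oriented even cycle with alternating inputs. -/

section Cycle

open Fin.CommRing

/-- The state after `t` rounds of the middle node of a path with IDs `x 0, …, x (2 * t)`, where the
nodes belong alternately to `α` only and to `β` only, the middle one to `α` iff `b`. Every node uses
port `0` towards its successor and port `1` towards its predecessor. -/
def windowState (A : ReconfAlgorithm) : ℕ → (ℕ → ℕ) → Bool → A.State
  | 0, x, b => A.init (x 0) (b, !b) 2
  | t + 1, x, b => A.recv (windowState A t (fun k => x (k + 1)) b)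
      {(0, A.send (windowState A t (fun k => x (k + 2)) !b) 1),
        (1, A.send (windowState A t x !b) 0)}

theorem windowState_congr (A : ReconfAlgorithm) (t : ℕ) : ∀ (x y : ℕ → ℕ) (b : Bool),
    (∀ k ≤ 2 * t, x k = y k) → windowState A t x b = windowState A t y b := by
  induction t with
  | zero => intro x y b h; simp [windowState, h 0]
  | succ t ih =>
    intro x y b h
    simp only [windowState]
    rw [ih (fun k => x (k + 1)) (fun k => y (k + 1)) b fun k hk => h _ (by omega),
      ih (fun k => x (k + 2)) (fun k => y (k + 2)) _ fun k hk => h _ (by omega),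
      ih x y _ fun k hk => h _ (by omega)]

variable {N : ℕ}

theorem cycle_succ_ne_pred (v : Fin (N + 3)) : v - 1 ≠ v + 1 := by
  intro h
  have h2 : (2 : Fin (N + 3)) = 0 := by linear_combination -h
  have := congrArg Fin.val h2
  change 2 % (N + 3) = 0 at this
  rw [Nat.mod_eq_of_lt (by omega)] at this
  omega

theorem neighborSet_cycle (v : Fin (N + 3)) :
    (SimpleGraph.cycleGraph (N + 3)).neighborSet v = {v - 1, v + 1} :=
  SimpleGraph.cycleGraph_neighborSet

theorem cycle_adj_iff {u v : Fin (N + 3)} :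
    (SimpleGraph.cycleGraph (N + 3)).Adj v u ↔ u = v - 1 ∨ u = v + 1 := by
  rw [← SimpleGraph.mem_neighborSet, neighborSet_cycle]
  simp

theorem ncard_neighborSet_cycle (v : Fin (N + 3)) :
    ((SimpleGraph.cycleGraph (N + 3)).neighborSet v).ncard = 2 := by
  rw [neighborSet_cycle, Set.ncard_pair (cycle_succ_ne_pred v)]

/-- The port numbering by a consistent orientation of the cycle. -/
def cyclePort (N : ℕ) : PortNumbering (SimpleGraph.cycleGraph (N + 3)) where
  port v u := if u = v + 1 then 0 else 1
  port_lt v u _ := by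
    rw [ncard_neighborSet_cycle]
    split_ifs <;> omega
  port_inj v := by
    rw [neighborSet_cycle]
    rintro a (rfl | rfl) b (rfl | rfl) h <;> simp_all [cycle_succ_ne_pred]

theorem even_val_succ (hN : Even (N + 3)) (v : Fin (N + 3)) :
    Even (v + 1).val ↔ ¬ Even v.val := by
  rw [Fin.val_add_one]
  split_ifs with h
  · subst h
    simp only [Fin.val_last, Even.zero, true_iff]
    rw [← Nat.even_add_one]
    exact hN
  · exact Nat.even_add_one

theorem even_val_pred (hN : Even (N + 3)) (v : Fin (N + 3)) :
    Even (v - 1).val ↔ ¬ Even v.val := by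
  have := even_val_succ hN (v - 1)
  rw [sub_add_cancel] at this
  tauto

/-- Indices are taken modulo `N + 3`, so this also holds when a window wraps around. Evenness makes
the inputs alternate across the seam. -/
theorem stateAfter_cycle (A : ReconfAlgorithm) (hN : Even (N + 3)) (id : Fin (N + 3) → ℕ) (t : ℕ) :
    ∀ v, A.stateAfter (SimpleGraph.cycleGraph (N + 3)) (cyclePort N) id
      (fun u => (decide (Even u.val), !decide (Even u.val))) t v =
      windowState A t (fun k => id (v - (t : Fin (N + 3)) + (k : Fin (N + 3))))
        (decide (Even v.val)) := by
  induction t with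
  | zero =>
    intro v
    simp only [LocalAlgorithm.stateAfter, windowState, ncard_neighborSet_cycle]
    simp
  | succ t ih =>
    intro v
    simp only [LocalAlgorithm.stateAfter, windowState, ih]
    have e0 : (fun k : ℕ => id (v - (t : Fin (N + 3)) + (k : Fin (N + 3)))) =
        fun k : ℕ => id (v - ((t + 1 : ℕ) : Fin (N + 3)) + ((k + 1 : ℕ) : Fin (N + 3))) := by
      funext k; congr 1; push_cast; ring
    have e1 : (fun k : ℕ => id (v + 1 - (t : Fin (N + 3)) + (k : Fin (N + 3)))) =
        fun k : ℕ => id (v - ((t + 1 : ℕ) : Fin (N + 3)) + ((k + 2 : ℕ) : Fin (N + 3))) := by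
      funext k; congr 1; push_cast; ring
    have e2 : (fun k : ℕ => id (v - 1 - (t : Fin (N + 3)) + (k : Fin (N + 3)))) =
        fun k : ℕ => id (v - ((t + 1 : ℕ) : Fin (N + 3)) + (k : Fin (N + 3))) := by
      funext k; congr 1; push_cast; ring
    have d1 : decide (Even (v + 1).val) = !decide (Even v.val) := by
      rw [← decide_not]; exact decide_eq_decide.2 (even_val_succ hN v)
    have d2 : decide (Even (v - 1).val) = !decide (Even v.val) := by
      rw [← decide_not]; exact decide_eq_decide.2 (even_val_pred hN v)
    rw [← e0, ← e1, ← e2, ← d1]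
    congr 1
    ext p
    have hp1 : (cyclePort N).port v (v + 1) = 0 := by simp [cyclePort]
    have hp2 : (cyclePort N).port v (v - 1) = 1 := by
      simp [cyclePort, cycle_succ_ne_pred]
    have hp3 : (cyclePort N).port (v + 1) v = 1 := by
      have := cycle_succ_ne_pred (v + 1)
      rw [add_sub_cancel_right] at this
      simp only [cyclePort, if_neg this]
    have hp4 : (cyclePort N).port (v - 1) v = 0 := by simp [cyclePort]
    simp only [Set.mem_ofPred_eq, cycle_adj_iff, Set.mem_insert_iff, Set.mem_singleton_iff,
      or_and_right, exists_or, exists_eq_left, hp1, hp2, hp3, hp4]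
    rw [d1, d2, or_comm]

/-- The even nodes of the cycle. -/
def evenNodes (N : ℕ) : Finset (Fin (N + 3)) := Finset.univ.filter fun v => Even v.val

theorem mem_evenNodes {v : Fin (N + 3)} : v ∈ evenNodes N ↔ Even v.val := by
  simp [evenNodes]

theorem isVertexCover_evenNodes (hN : Even (N + 3)) :
    (SimpleGraph.cycleGraph (N + 3)).IsVertexCover (evenNodes N : Set (Fin (N + 3))) := by
  intro v u h
  simp only [Finset.mem_coe, mem_evenNodes]
  rcases cycle_adj_iff.1 h with rfl | rfl
  · rw [even_val_pred hN]; tauto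
  · rw [even_val_succ hN]; tauto

theorem isVertexCover_compl_evenNodes (hN : Even (N + 3)) :
    (SimpleGraph.cycleGraph (N + 3)).IsVertexCover ((evenNodes N)ᶜ : Finset (Fin (N + 3))) := by
  intro v u h
  simp only [Finset.mem_coe, Finset.mem_compl, mem_evenNodes]
  rcases cycle_adj_iff.1 h with rfl | rfl
  · rw [even_val_pred hN]; tauto
  · rw [even_val_succ hN]; tauto

theorem card_evenNodes_add (hN : Even (N + 3)) :
    (evenNodes N).card = (evenNodes N)ᶜ.card := by
  refine Finset.card_bij' (fun v _ => v + 1) (fun v _ => v - 1) ?_ ?_ ?_ ?_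
  · intro v hv
    simpa only [Finset.mem_compl, mem_evenNodes, even_val_succ hN, not_not] using hv
  · intro v hv
    simpa only [Finset.mem_compl, mem_evenNodes, even_val_pred hN] using hv
  · intro v _; simp
  · intro v _; simp

theorem two_mul_card_evenNodes (hN : Even (N + 3)) : 2 * (evenNodes N).card = N + 3 := by
  have h := Finset.card_add_card_compl (evenNodes N)
  rw [← card_evenNodes_add hN, Fintype.card_fin] at h
  omega

/-- A single batch would change every node, which is not independent. The bound makes `logStar ℓ`
positive. -/
theorem two_le_batches (hN : Even (N + 3)) {ℓ : ℕ} {s : ℝ} {S : ℕ → Finset (Fin (N + 3))}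
    (hS : IsSchedule (SimpleGraph.cycleGraph (N + 3)) (evenNodes N) (evenNodes N)ᶜ ℓ s S) :
    2 ≤ ℓ := by
  have h0 : (0 : Fin (N + 3)) ∈ evenNodes N := by simp [mem_evenNodes]
  have h1 : (0 + 1 : Fin (N + 3)) ∉ evenNodes N := by
    rw [mem_evenNodes, even_val_succ hN]
    simp
  by_contra hℓ
  have hℓ' : ℓ = 0 ∨ ℓ = 1 := by omega
  rcases hℓ' with rfl | rfl
  · have := hS.first.symm.trans hS.last
    have h0' := h0
    rw [this, Finset.mem_compl] at h0'
    exact h0' h0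
  · have h := hS.indep 0 one_pos
    rw [zero_add, hS.first, hS.last] at h
    have hadj : (SimpleGraph.cycleGraph (N + 3)).Adj 0 (0 + 1) := cycle_adj_iff.2 (.inr rfl)
    refine h (Finset.mem_coe.2 ?_) (Finset.mem_coe.2 ?_) hadj.ne hadj
    · rw [Finset.mem_symmDiff, Finset.mem_compl]
      exact .inl ⟨h0, not_not.2 h0⟩
    · rw [Finset.mem_symmDiff, Finset.mem_compl]
      exact .inr ⟨h1, h1⟩

end Cycle

/-! ### Simultaneous joining forces an expensive cover. -/

section Cost

open Fin.CommRing

variable {N : ℕ}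

/-- The first time at which a node outside `α` that sees the window `x` enters the cover. -/
noncomputable def joinTime (A : ReconfAlgorithm) (T ℓ : ℕ) (x : ℕ → ℕ) : Fin (ℓ + 1) :=
  ⟨min ℓ (sInf {i | A.out (windowState A T x false) i = true}), by omega⟩

theorem joinTime_congr (A : ReconfAlgorithm) (T ℓ : ℕ) (x y : ℕ → ℕ)
    (h : ∀ k ≤ 2 * T, x k = y k) : joinTime A T ℓ x = joinTime A T ℓ y := by
  simp only [joinTime, windowState_congr A T x y false h]

theorem mem_schedule_cycle (A : ReconfAlgorithm) (hN : Even (N + 3)) (id : Fin (N + 3) → ℕ)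
    (T i : ℕ) (v : Fin (N + 3)) :
    v ∈ A.schedule (SimpleGraph.cycleGraph (N + 3)) (cyclePort N) id (evenNodes N)
        (evenNodes N)ᶜ T i ↔
      A.out (windowState A T (fun k => id (v - (T : Fin (N + 3)) + (k : Fin (N + 3))))
        (decide (Even v.val))) i = true := by
  simp only [ReconfAlgorithm.schedule, LocalAlgorithm.output, Finset.mem_filter, Finset.mem_univ,
    true_and, ← stateAfter_cycle A hN, Finset.mem_compl, mem_evenNodes, decide_not]

/-- The window of a node `v` that is far from the end points `0` and `N + 2`. -/
theorem val_window {T p k : ℕ} {v : Fin (N + 3)} (hv : v.val = T + p) (hp : p + 2 * T < N + 3)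
    (hk : k ≤ 2 * T) : (v - (T : Fin (N + 3)) + (k : Fin (N + 3))).val = p + k := by
  have h : v - (T : Fin (N + 3)) + (k : Fin (N + 3)) = ((p + k : ℕ) : Fin (N + 3)) := by
    have h1 : v = ((T + p : ℕ) : Fin (N + 3)) := by rw [← hv, Fin.cast_val_eq_self]
    rw [h1]
    push_cast
    ring
  rw [h, Fin.val_natCast, Nat.mod_eq_of_lt (by omega)]

/-- When an odd node joins, its predecessor has not left yet. -/
theorem mem_of_joinTime_eq (A : ReconfAlgorithm) (hN : Even (N + 3)) {T ℓ : ℕ} {s : ℝ}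
    {id : Fin (N + 3) → ℕ} {a : Fin (ℓ + 1)} {v : Fin (N + 3)}
    (hS : IsSchedule (SimpleGraph.cycleGraph (N + 3)) (evenNodes N) (evenNodes N)ᶜ ℓ s
      (A.schedule (SimpleGraph.cycleGraph (N + 3)) (cyclePort N) id (evenNodes N)
        (evenNodes N)ᶜ T))
    (hv : v ∉ evenNodes N)
    (ha : joinTime A T ℓ (fun k => id (v - (T : Fin (N + 3)) + (k : Fin (N + 3)))) = a) :
    1 ≤ a.val ∧
      v ∈ A.schedule (SimpleGraph.cycleGraph (N + 3)) (cyclePort N) id (evenNodes N)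
        (evenNodes N)ᶜ T a ∧
      v - 1 ∈ A.schedule (SimpleGraph.cycleGraph (N + 3)) (cyclePort N) id (evenNodes N)
        (evenNodes N)ᶜ T a := by
  set S := A.schedule (SimpleGraph.cycleGraph (N + 3)) (cyclePort N) id (evenNodes N)
        (evenNodes N)ᶜ T with hSdef
  have hI : {i | A.out (windowState A T
      (fun k => id (v - (T : Fin (N + 3)) + (k : Fin (N + 3)))) false) i = true} =
      {i | v ∈ S i} := by
    ext i
    rw [Set.mem_ofPred_eq, Set.mem_ofPred_eq, hSdef, mem_schedule_cycle A hN,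
      decide_eq_false (mem_evenNodes.not.1 hv)]
  have hℓ : ℓ ∈ {i | v ∈ S i} := by
    rw [Set.mem_ofPred_eq, hS.last]
    exact Finset.mem_compl.2 hv
  -- The cap at `ℓ` is inactive, because `v` belongs to the final cover.
  have hav : a.val = sInf {i | v ∈ S i} := by
    rw [← ha]
    change min ℓ (sInf _) = _
    rw [hI]
    exact min_eq_right (Nat.sInf_le hℓ)
  have hva : v ∈ S a := by
    rw [hav]
    exact Nat.sInf_mem ⟨ℓ, hℓ⟩
  have ha1 : 1 ≤ a.val := by
    by_contra h
    rw [show a.val = 0 by omega, hS.first] at hva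
    exact hv hva
  obtain ⟨b, hb⟩ : ∃ b, a.val = b + 1 := ⟨a.val - 1, by omega⟩
  have hbℓ : b < ℓ := by have := a.isLt; omega
  have hvb : v ∉ S b := fun h => by
    have := Nat.sInf_le (s := {i | v ∈ S i}) h
    omega
  have hadj : (SimpleGraph.cycleGraph (N + 3)).Adj v (v - 1) := cycle_adj_iff.2 (.inl rfl)
  have hub : v - 1 ∈ S b := by
    rcases hS.cover b hbℓ.le hadj with h | h
    · exact absurd h hvb
    · exact h
  refine ⟨ha1, hva, ?_⟩
  rw [hb] at hva ⊢
  by_contra hua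
  exact hS.indep b hbℓ (Finset.mem_coe.2 (Finset.mem_symmDiff.2 (.inr ⟨hva, hvb⟩)))
    (Finset.mem_coe.2 (Finset.mem_symmDiff.2 (.inl ⟨hub, hua⟩))) hadj.ne hadj

/-- The odd nodes whose window lies within a block, for blocks of length `m + 2 * T`. -/
def innerNodes (N T m : ℕ) : Finset (Fin (N + 3)) :=
  (evenNodes N)ᶜ.filter fun v =>
    T ≤ v.val ∧ v.val + T < N + 3 ∧ (v.val - T) % (m + 2 * T) < m

theorem card_innerNodes (hN : Even (N + 3)) (T m s : ℕ) (hm : 0 < m)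
    (hs : N + 3 ≤ s * (m + 2 * T)) :
    (N + 3 : ℕ) ≤ 2 * (innerNodes N T m).card + 4 * T * (s + 1) := by
  -- `D` over-counts the lost odd positions: `T` at either end of the cycle and `2 * T` window
  -- starts per block whose window crosses a block boundary.
  classical
  set D : Finset ℕ := Finset.range T ∪ Finset.Ico (N + 3 - T) (N + 3) ∪
    (Finset.range s ×ˢ Finset.Ico m (m + 2 * T)).image
      (fun q => T + ((m + 2 * T) * q.1 + q.2)) with hD
  have hDc : D.card ≤ 2 * T * (s + 1) := by
    calc D.card ≤ T + T + s * (2 * T) := by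
          refine (Finset.card_union_le _ _).trans (add_le_add
            ((Finset.card_union_le _ _).trans (add_le_add (by simp) ?_))
            (Finset.card_image_le.trans (by simp)))
          rw [Nat.card_Ico]
          omega
      _ = 2 * T * (s + 1) := by ring
  have hsub : ((evenNodes N)ᶜ \ innerNodes N T m).card ≤ D.card := by
    refine Finset.card_le_card_of_injOn Fin.val ?_ Fin.val_injective.injOn
    intro v hv
    rw [Finset.mem_coe, Finset.mem_sdiff, innerNodes, Finset.mem_filter] at hv
    have hv' : ¬ (T ≤ v.val ∧ v.val + T < N + 3 ∧ (v.val - T) % (m + 2 * T) < m) :=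
      fun h => hv.2 ⟨hv.1, h⟩
    have hlt := v.isLt
    rw [Finset.mem_coe, hD, Finset.mem_union, Finset.mem_union, Finset.mem_range, Finset.mem_Ico]
    by_cases h1 : v.val < T
    · exact .inl (.inl h1)
    by_cases h2 : v.val + T < N + 3
    · refine .inr (Finset.mem_image.2 ⟨((v.val - T) / (m + 2 * T), (v.val - T) % (m + 2 * T)), ?_, ?_⟩)
      · rw [Finset.mem_product, Finset.mem_range, Finset.mem_Ico]
        refine ⟨Nat.div_lt_of_lt_mul ?_, ?_, Nat.mod_lt _ (by omega)⟩
        · rw [Nat.mul_comm]; omega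
        · by_contra h3
          exact hv' ⟨by omega, h2, by omega⟩
      · dsimp only
        rw [Nat.div_add_mod]
        omega
    · exact .inl (.inr ⟨by omega, hlt⟩)
  have hle := Finset.le_card_sdiff (innerNodes N T m) (evenNodes N)ᶜ
  have h1 := two_mul_card_evenNodes hN
  rw [card_evenNodes_add hN] at h1
  have : 4 * T * (s + 1) = 2 * (2 * T * (s + 1)) := by ring
  omega

theorem cost_lower_bound (A : ReconfAlgorithm) (hN : Even (N + 3)) {R T ℓ m s : ℕ} {η a : ℝ}
    (hA : A.ComputesMonotoneApprox (SimpleGraph.cycleGraph (N + 3)) R T ℓ η a)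
    (hm : 0 < m) (hs : N + 3 ≤ s * (m + 2 * T))
    (hR : (2 ^ ·)^[2 * T] ((ℓ + 1) * 2 ^ m) + (ℓ + 1) * s * (m + 2 * T) < R)
    (hT : 4 * T * (s + 1) < N + 3) :
    (N + 3 : ℝ) ≤ η * ((N + 3) / 2) + a + 4 * T * (s + 1) := by
  classical
  obtain ⟨b, y, hyX, hyinj, hyc⟩ := exists_block_sequence (2 * T) m s (Finset.range R)
    (joinTime A T ℓ) (joinTime_congr A T ℓ) (by omega) (by simpa using hR)
  let id : Fin (N + 3) → ℕ := fun v => y v.val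
  obtain ⟨hS, -⟩ := hA (evenNodes N) (evenNodes N)ᶜ id (cyclePort N)
    (isVertexCover_evenNodes hN) (isVertexCover_compl_evenNodes hN)
    (fun u v h => Fin.val_injective (hyinj (u.isLt.trans_le hs) (v.isLt.trans_le hs) h))
    (fun v => Finset.mem_range.1 (hyX _ (v.isLt.trans_le hs)))
  have hin : ∀ v ∈ innerNodes N T m, _ := fun v hv => by
    rw [innerNodes, Finset.mem_filter, Finset.mem_compl] at hv
    obtain ⟨hv, h1, h2, h3⟩ := hv
    refine mem_of_joinTime_eq A hN hS hv ((joinTime_congr A T ℓ _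
      (fun k => y (v.val - T + k)) fun k hk => ?_).trans (hyc _ (by omega) h3))
    exact congrArg y (val_window (by omega) (by omega) hk)
  set S := A.schedule (SimpleGraph.cycleGraph (N + 3)) (cyclePort N) id (evenNodes N)
    (evenNodes N)ᶜ T
  have hcard := card_innerNodes hN T m s hm hs
  -- One inner node suffices to know that the common joining time is positive, hence ends some batch
  -- `d`.
  obtain ⟨v₀, hv₀⟩ : (innerNodes N T m).Nonempty := by
    rw [← Finset.card_pos]
    omega
  obtain ⟨d, hd⟩ : ∃ d, b.val = d + 1 := ⟨b.val - 1, by have := (hin v₀ hv₀).1; omega⟩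
  have hSb : 2 * (innerNodes N T m).card ≤ (S b).card := by
    have hdisj : Disjoint (innerNodes N T m) ((innerNodes N T m).image (· - 1)) := by
      rw [Finset.disjoint_left]
      intro v hv hv'
      obtain ⟨u, hu, rfl⟩ := Finset.mem_image.1 hv'
      rw [innerNodes, Finset.mem_filter, Finset.mem_compl, mem_evenNodes] at hu hv
      exact hv.1 ((even_val_pred hN u).2 hu.1)
    calc 2 * (innerNodes N T m).card
        = (innerNodes N T m ∪ (innerNodes N T m).image (· - 1)).card := by
          rw [Finset.card_union_of_disjoint hdisj,
            Finset.card_image_of_injective _ (sub_left_injective), two_mul]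
      _ ≤ (S b).card := by
          refine Finset.card_le_card (Finset.union_subset (fun v hv => (hin v hv).2.1) ?_)
          intro v hv
          obtain ⟨u, hu, rfl⟩ := Finset.mem_image.1 hv
          exact (hin u hu).2.2
  have hcost := hS.cost d (by have := b.isLt; omega)
  rw [← card_evenNodes_add hN, max_self, ← hd] at hcost
  have h1 : ((S b).card : ℝ) ≤ ((S d ∪ S b).card : ℝ) :=
    Nat.cast_le.2 (Finset.card_le_card Finset.subset_union_right)
  have h2 : ((evenNodes N).card : ℝ) = (N + 3) / 2 := by
    have : (2 * (evenNodes N).card : ℝ) = N + 3 := by exact_mod_cast two_mul_card_evenNodes hN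
    linarith
  rw [h2] at hcost
  have h3 : ((N + 3 : ℕ) : ℝ) ≤ ((S b).card + 4 * T * (s + 1) : ℕ) :=
    Nat.cast_le.2 (by omega)
  push_cast at h3
  linarith

end Cost

/-! ### Power towers and the choice of parameters. -/

theorem tower_strictMono : StrictMono tower :=
  strictMono_nat_of_lt_succ fun _ => Nat.lt_two_pow_self

theorem two_pow_le_tower (k : ℕ) : 2 ^ k ≤ tower k := by
  cases k with
  | zero => simp [tower]
  | succ k => exact Nat.pow_le_pow_right two_pos (lt_tower k)

theorem le_tower_logStar (n : ℕ) : n ≤ tower (logStar n) := Nat.find_spec (exists_le_tower n)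

theorem lt_logStar_iff {k n : ℕ} : k < logStar n ↔ tower k < n := by
  rw [logStar, Nat.lt_find_iff]
  refine ⟨fun h => not_le.1 (h k le_rfl), fun h j hj => not_le.2 ?_⟩
  exact (tower_strictMono.monotone hj).trans_lt h

theorem iterate_two_pow_le_tower {q u : ℕ} (h : q ≤ tower u) (k : ℕ) :
    (2 ^ ·)^[k] q ≤ tower (u + k) := by
  induction k with
  | zero => exact h
  | succ k ih =>
    rw [Function.iterate_succ_apply']
    exact Nat.pow_le_pow_right two_pos ih

/-- The refined colouring costs only two tower levels. -/
theorem succ_mul_two_pow_le_tower {ℓ m u : ℕ} (hℓ : ℓ ≤ tower u) (hm : m ≤ tower u) :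
    (ℓ + 1) * 2 ^ m ≤ tower (u + 2) := by
  have h1 : ℓ + m ≤ tower (u + 1) := by
    have : 2 * tower u ≤ 2 ^ tower u := Nat.mul_le_pow (by norm_num) _
    change ℓ + m ≤ 2 ^ tower u
    omega
  calc (ℓ + 1) * 2 ^ m ≤ 2 ^ ℓ * 2 ^ m := Nat.mul_le_mul_right _ Nat.lt_two_pow_self
    _ = 2 ^ (ℓ + m) := (pow_add _ _ _).symm
    _ ≤ tower (u + 2) := Nat.pow_le_pow_right two_pos h1

theorem mul_succ_le_tower_div_four {C L : ℕ} (h : 64 * C ≤ L) : C * (L + 1) ≤ tower (L / 4) := by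
  set q := L / 8 with hq
  have hlt : q < 2 ^ q := Nat.lt_two_pow_self
  calc C * (L + 1) ≤ C * (8 * (q + 1)) := Nat.mul_le_mul_left _ (by omega)
    _ = (8 * C) * (q + 1) := by ring
    _ ≤ (q + 1) * (q + 1) := Nat.mul_le_mul_right _ (by omega)
    _ ≤ 2 ^ q * 2 ^ q := Nat.mul_le_mul hlt hlt
    _ = 2 ^ (q + q) := (pow_add _ _ _).symm
    _ ≤ 2 ^ (L / 4) := Nat.pow_le_pow_right two_pos (by omega)
    _ ≤ tower (L / 4) := two_pow_le_tower _

/-- Blocks have `C * T + 1` good windows with `C` of order `1 / ε`, so the `2 * T` bad ones are a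
small fraction. -/
theorem logStar_le_of_computes {N R T ℓ C : ℕ} {ε a : ℝ} (A : ReconfAlgorithm)
    (hN : Even (N + 3)) (hε : 0 < ε) (hε1 : ε < 1) (ha : 0 ≤ a) (hC : 20 + 4 * a ≤ C * ε)
    (hL : 64 * (C + 2) ≤ logStar (N + 3)) (hR : N + 3 ≤ R) (hR' : 8 * ((N + 3) * ℓ) ≤ R)
    (hA : A.ComputesMonotoneApprox (SimpleGraph.cycleGraph (N + 3)) R T ℓ (2 - ε) a) :
    logStar (N + 3) ≤ 8 * (T * logStar ℓ) := by
  by_contra! hlt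
  have hℓ : 2 ≤ ℓ := two_le_batches hN (hA (evenNodes N) (evenNodes N)ᶜ Fin.val (cyclePort N)
    (isVertexCover_evenNodes hN) (isVertexCover_compl_evenNodes hN) Fin.val_injective
    (fun v => v.isLt.trans_le hR)).1
  have hs : 0 < logStar ℓ := lt_logStar_iff.2 hℓ
  set L := logStar (N + 3) with hLdef
  have hT : 8 * T < L := by
    have : T * 1 ≤ T * logStar ℓ := Nat.mul_le_mul_left _ hs
    omega
  have hgrow := mul_succ_le_tower_div_four hL
  have hn : (C + 2) * (L + 1) < N + 3 :=
    hgrow.trans_lt (lt_logStar_iff.1 (by omega))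
  have hCT : C * T ≤ C * L := Nat.mul_le_mul_left _ (by omega)
  have hexp : (C + 2) * (L + 1) = C * L + C + 2 * L + 2 := by ring
  have hC20 : 20 ≤ C := by
    have : (20 : ℝ) ≤ C := by nlinarith [(Nat.cast_nonneg C : (0 : ℝ) ≤ C)]
    exact_mod_cast this
  have hE : (2 ^ ·)^[2 * T] ((ℓ + 1) * 2 ^ (C * T + 1)) ≤ (N + 3) * ℓ := by
    -- For `T = 0` the assumption says nothing about `logStar ℓ`, but nothing is iterated either.
    -- Otherwise the tower height is at most `L / 4 + 2 + 2 * T`, which is below `L`.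
    rcases Nat.eq_zero_or_pos T with rfl | hT0
    · simp only [mul_zero, Function.iterate_zero, id, zero_add, pow_one]
      nlinarith
    · have hsL : logStar ℓ ≤ L / 4 := by
        have : 1 * logStar ℓ ≤ T * logStar ℓ := Nat.mul_le_mul_right _ hT0
        omega
      have h := iterate_two_pow_le_tower (succ_mul_two_pow_le_tower
        ((le_tower_logStar ℓ).trans (tower_strictMono.monotone hsL))
        (show C * T + 1 ≤ tower (L / 4) by omega)) (2 * T)
      have h2 : tower (L / 4 + 2 + 2 * T) < N + 3 := lt_logStar_iff.1 (by omega)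
      exact (h.trans h2.le).trans (Nat.le_mul_of_pos_right _ (by omega))
  set B := C * T + 1 + 2 * T with hB
  have hBn : B ≤ N + 3 := by omega
  have hBpos : 0 < B := by omega
  set q := (N + 3) / B with hq
  have hqB : q * B ≤ N + 3 := Nat.div_mul_le_self _ _
  have hsB : N + 3 ≤ (q + 1) * B := by
    have := Nat.lt_div_mul_add hBpos (a := N + 3)
    rw [← hq] at this
    rw [Nat.succ_mul]
    omega
  -- The two terms are at most `(N + 3) * ℓ` and `3 * (N + 3) * ℓ`, against `8 * (N + 3) * ℓ` IDs.
  have hsize : (2 ^ ·)^[2 * T] ((ℓ + 1) * 2 ^ (C * T + 1)) +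
      (ℓ + 1) * (q + 1) * (C * T + 1 + 2 * T) < R := by
    have h1 : (ℓ + 1) * (q + 1) * (C * T + 1 + 2 * T) ≤ (ℓ + 1) * (2 * (N + 3)) := by
      rw [Nat.mul_assoc]
      refine Nat.mul_le_mul_left _ ?_
      rw [← hB, Nat.succ_mul]
      omega
    have h2 : (ℓ + 1) * (2 * (N + 3)) = 2 * ((N + 3) * ℓ) + 2 * (N + 3) := by ring
    have h3 : (N + 3) * 2 ≤ (N + 3) * ℓ := Nat.mul_le_mul_left _ hℓ
    omega
  have hTq : (16 : ℝ) * (T * q) ≤ ε * (N + 3) := by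
    have h1 : C * (T * q) ≤ N + 3 := by
      refine le_trans ?_ hqB
      rw [hB]
      nlinarith [Nat.zero_le (q * T), Nat.zero_le q]
    have h2 : (C : ℝ) * (T * q) ≤ N + 3 := by exact_mod_cast h1
    have h3 : (0 : ℝ) ≤ T * q := by positivity
    nlinarith
  have hTL : (8 : ℝ) * T ≤ L := by exact_mod_cast hT.le
  have hnr : ((C : ℝ) + 2) * (L + 1) ≤ N + 3 := by exact_mod_cast hn.le
  have hL0 : (0 : ℝ) ≤ L := Nat.cast_nonneg L
  have hN0 : (0 : ℝ) ≤ N := Nat.cast_nonneg N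
  have hLn : (20 : ℝ) * (L + 1) ≤ N + 3 := by
    have : (20 : ℝ) ≤ C := by exact_mod_cast hC20
    nlinarith
  have hbad : 4 * T * (q + 1 + 1) < N + 3 := by
    have : (4 : ℝ) * T * (q + 1 + 1) < N + 3 := by nlinarith
    exact_mod_cast this
  have hcost := cost_lower_bound A hN hA (Nat.succ_pos (C * T)) hsB hsize hbad
  push_cast at hcost
  have h5 : (20 + 4 * a) * (L + 1) ≤ ε * (N + 3) := by
    calc (20 + 4 * a) * (L + 1) ≤ (C * ε) * (L + 1) := by gcongr
      _ = ε * (C * (L + 1)) := by ring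
      _ ≤ ε * (N + 3) := by
        refine mul_le_mul_of_nonneg_left ?_ hε.le
        linarith
  -- The cost bound leaves `ε n / 2 ≤ a + 4 T q + 8 T`, where `n = N + 3`. Here `4 T q ≤ ε n / 4`
  -- and `8 T ≤ L`, while `ε n / 4 ≥ (5 + a) (L + 1)`.
  nlinarith

theorem eventually_logStar_le (ε a : ℝ) (ℓ R T : ℕ → ℕ) (A : ℕ → ReconfAlgorithm)
    (hε : 0 < ε) (hε1 : ε < 1) (ha : 0 ≤ a) (hR : ∀ᶠ n in Filter.atTop, n ≤ R n)
    (hR' : ∃ K : ℝ, 0 < K ∧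
      ∀ᶠ n : ℕ in Filter.atTop, K * ((n : ℝ) * (ℓ n : ℝ) * Real.log n) ≤ (R n : ℝ))
    (hA : ∀ᶠ n in Filter.atTop, Even n →
      (A n).ComputesMonotoneApprox (SimpleGraph.cycleGraph n) (R n) (T n) (ℓ n) (2 - ε) a) :
    ∀ᶠ n in Filter.atTop, Even n →
      (1 / 8 : ℝ) * (logStar n : ℝ) ≤ (T n : ℝ) * (logStar (ℓ n) : ℝ) := by
  obtain ⟨K, hK, hR'⟩ := hR'
  obtain ⟨C, hC⟩ := exists_nat_ge ((20 + 4 * a) / ε)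
  rw [div_le_iff₀ hε] at hC
  -- The factor `log n` of the ID space absorbs the constant `8 / K`.
  have hlog : ∀ᶠ n : ℕ in Filter.atTop, 8 / K ≤ Real.log n :=
    (Real.tendsto_log_atTop.comp tendsto_natCast_atTop_atTop).eventually_ge_atTop _
  filter_upwards [hR, hR', hA, hlog, Filter.eventually_ge_atTop 3,
    Filter.eventually_gt_atTop (tower (64 * (C + 2)))] with n h1 h2 h3 h4 h5 h6 hn
  have hRn : 8 * (n * ℓ n) ≤ R n := by
    rw [div_le_iff₀ hK] at h4
    have : (8 : ℝ) * (n * ℓ n) ≤ R n := by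
      refine le_trans ?_ h2
      calc (8 : ℝ) * (n * ℓ n) ≤ (Real.log n * K) * (n * ℓ n) := by gcongr
        _ = _ := by ring
    exact_mod_cast this
  have hLn := (lt_logStar_iff.2 h6).le
  have key := h3 hn
  generalize R n = r at *
  generalize T n = t at *
  generalize ℓ n = l at *
  generalize A n = alg at *
  obtain ⟨N, rfl⟩ : ∃ N, n = N + 3 := ⟨n - 3, by omega⟩
  have h := logStar_le_of_computes alg hn hε hε1 ha hC hLn h1 hRn key
  have h' : (logStar (N + 3) : ℝ) ≤ 8 * (t * logStar l) := by exact_mod_cast h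
  linarith

end VCReconf

/-- The first conjunct is the lower bound `T = Ω(log* n / log* ℓ(n))`, with the denominator cleared
(`log* ℓ(n) = 0` if `ℓ(n) ≤ 1`). The second one is its consequence for a constant number of batches
and a constant additive error, i.e. the tightness of `O(log* n)` rounds. -/
theorem theorem56 :
    (∃ c : ℝ, 0 < c ∧
      ∀ (ε : ℝ) (ℓ R T : ℕ → ℕ) (A : ℕ → VCReconf.ReconfAlgorithm),
        0 < ε → ε < 1 →
        (∀ᶠ n in Filter.atTop, ℓ n < n) →
        (∀ᶠ n in Filter.atTop, n ≤ R n) →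
        (∃ K : ℝ, 0 < K ∧
          ∀ᶠ n : ℕ in Filter.atTop, K * ((n : ℝ) * (ℓ n : ℝ) * Real.log n) ≤ (R n : ℝ)) →
        (∀ᶠ n in Filter.atTop, Even n →
          (A n).ComputesMonotoneApprox (SimpleGraph.cycleGraph n) (R n) (T n) (ℓ n) (2 - ε) 0) →
        ∀ᶠ n in Filter.atTop, Even n →
          c * (VCReconf.logStar n : ℝ) ≤ (T n : ℝ) * (VCReconf.logStar (ℓ n) : ℝ)) ∧
    (∀ (ε a : ℝ) (L : ℕ), 0 < ε → ε < 1 → 0 ≤ a →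
      ∃ c : ℝ, 0 < c ∧
        ∀ (R T : ℕ → ℕ) (A : ℕ → VCReconf.ReconfAlgorithm),
          (∀ᶠ n in Filter.atTop, n ≤ R n) →
          (∃ K : ℝ, 0 < K ∧
            ∀ᶠ n : ℕ in Filter.atTop, K * ((n : ℝ) * Real.log n) ≤ (R n : ℝ)) →
          (∀ᶠ n in Filter.atTop, Even n →
            (A n).ComputesMonotoneApprox (SimpleGraph.cycleGraph n) (R n) (T n) L (2 - ε) a) →
          ∀ᶠ n in Filter.atTop, Even n →
            c * (VCReconf.logStar n : ℝ) ≤ (T n : ℝ)) := by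

  refine ⟨⟨1 / 8, by norm_num, fun ε ℓ R T A hε hε1 _ hR hR' hA =>
    VCReconf.eventually_logStar_le ε 0 ℓ R T A hε hε1 le_rfl hR hR' hA⟩, ?_⟩
  intro ε a L hε hε1 ha
  -- Adding `1` avoids division by zero when `L ≤ 1`; likewise `L + 1` in the constant `K / (L +
  -- 1)`.
  refine ⟨1 / 8 / (VCReconf.logStar L + 1), by positivity, fun R T A hR hR' hA => ?_⟩
  obtain ⟨K, hK, hR'⟩ := hR'
  filter_upwards [VCReconf.eventually_logStar_le ε a (fun _ => L) R T A hε hε1 ha hR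
    ⟨K / (L + 1), by positivity, by
      filter_upwards [hR'] with n hn
      refine le_trans ?_ hn
      have hlog : 0 ≤ Real.log n := Real.log_natCast_nonneg n
      rw [show K / (L + 1) * (n * L * Real.log n) = K * (n * Real.log n) * (L / (L + 1)) by ring]
      refine mul_le_of_le_one_right (by positivity) ?_
      rw [div_le_one (by positivity)]
      linarith⟩ hA] with n hn heven
  have h := hn heven
  rw [div_mul_eq_mul_div, div_le_iff₀ (by positivity)]
  have hT : (0 : ℝ) ≤ T n := Nat.cast_nonneg _
  linarith
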